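/- Let $(X,d)$ be a compact metric space and $\mu$ a Borel probability measure on $X$. An \emph{observable} is a function $f\colon X\to\mathbb{R}$ with $|f(x)-f(y)|\le d(x,y)$ for all $x,y\in X$; let $\mathcal{O}(X)$ be the set of observables, with the metric of the sup norm. For a Borel probability measure $\nu$ on $X$ put $M_\nu(f)=\int_X f\,d\nu$ and $\mathcal{O}_\nu=\{f\in\mathcal{O}(X): M_\nu(f)=0\}$, and let $\Sigma_\nu\colon\mathcal{O}_\nu\times\mathcal{O}_\nu\to\mathbb{R}$, $\Sigma_\nu(f,g)=\int_X fg\,d\nu$, be the observable covariance. For functions $\phi\colon A\to\mathbb{R}$ and $\psi\colon B\to\mathbb{R}$ on subsets $A,B$ of a metric space $(Z,d_Z)$, let $d_H(\phi,\psi)$ be the infimum of all $\varepsilon>0$ such that for every $a\in A$ there is $b\in B$ with $d_Z(a,b)<\varepsilon$ and $|\phi(a)-\psi(b)|<\varepsilon$, and for every $b\in B$ there is $a\in A$ with the same two properties. It is applied to $\Sigma_\mu,\Sigma_\nu$ with $Z$ the space of pairs $(f,g)$ of continuous functions on $X$, with the metric of the norm $\max\{\|f\|_\infty,\|g\|_\infty\}$.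 Let $x_1,x_2,\dots$ be independent random draws from $\mu$, that is, let $(x_i)_{i\ge1}\in X^{\mathbb{N}}$ be distributed according to the infinite product measure $\otimes_\infty\mu$, and let $\mu_n=\frac1n\sum_{i=1}^n\delta_{x_i}$ for $n\ge1$ be the empirical measures. Then: (i) $\otimes_\infty\mu$-almost surely, $|M_\mu(f)-M_{\mu_n}(f)|\to0$ as $n\to\infty$, uniformly in $f\in\mathcal{O}(X)$; (ii) $\otimes_\infty\mu$-almost surely, $d_H(\Sigma_\mu,\Sigma_{\mu_n})\to0$ as $n\to\infty$. -/

import Mathlib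

open Filter Topology MeasureTheory
open scoped ENNReal

noncomputable section

namespace MetricObservables

section Functional

variable {Z : Type*} [MetricSpace Z]

/-- `ε > 0` is admissible for functions `φ : A → ℝ` and `ψ : B → ℝ` defined on subsets `A`, `B` of
a metric space `Z`. -/
def Admissible {A B : Set Z} (φ : A → ℝ) (ψ : B → ℝ) (ε : ℝ) : Prop :=
  0 < ε ∧
    (∀ a : A, ∃ b : B, dist (a : Z) (b : Z) < ε ∧ |φ a - ψ b| < ε) ∧
    (∀ b : B, ∃ a : A, dist (a : Z) (b : Z) < ε ∧ |φ a - ψ b| < ε)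

/-- The (functional) Hausdorff distance between `φ : A → ℝ` and `ψ : B → ℝ`, the infimum of all
admissible `ε`. It is taken in `[0, ∞]`, so that the infimum would be `∞`, and not a junk value,
if no `ε` were admissible. -/
def functionalHausdorffDist {A B : Set Z} (φ : A → ℝ) (ψ : B → ℝ) : ℝ≥0∞ :=
  ⨅ (ε : ℝ) (_ : Admissible φ ψ ε), ENNReal.ofReal ε

end Functional

variable {X : Type*} [MetricSpace X] [MeasurableSpace X]

/-- The metric observables of `X`, that is, the `1`-Lipschitz functions `X → ℝ`. They are
continuous, and are regarded as elements of `C(X, ℝ)`, whose metric for compact `X` is the one of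
the sup norm. -/
def observables (X : Type*) [MetricSpace X] : Set C(X, ℝ) :=
  {f | ∀ x y : X, |f x - f y| ≤ dist x y}

/-- The mean functional `M_μ f = ∫ f dμ`. -/
def meanFunctional (μ : Measure X) (f : C(X, ℝ)) : ℝ := ∫ x, f x ∂μ

/-- The `μ`-centered observables. -/
def centeredObservables (μ : Measure X) : Set C(X, ℝ) :=
  {f | f ∈ observables X ∧ meanFunctional μ f = 0}

/-- The observable covariance `Σ_μ (f, g) = ∫ f g dμ`, a function on pairs of `μ`-centered
observables. The metric of `C(X, ℝ) × C(X, ℝ)` is the one of the norm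
`max ‖f‖ ‖g‖`. -/
def observableCovariance (μ : Measure X) :
    ↥(centeredObservables μ ×ˢ centeredObservables μ : Set (C(X, ℝ) × C(X, ℝ))) → ℝ :=
  fun p => ∫ x, p.1.1 x * p.1.2 x ∂μ

/-- The empirical measure `(1 / n) ∑ δ_{x_i}` of the first `n` terms of a sequence (used for
`n ≥ 1`; for `n = 0` this is the zero measure). -/
def empiricalMeasure (x : ℕ → X) (n : ℕ) : Measure X :=
  (n : ℝ≥0∞)⁻¹ • ∑ i ∈ Finset.range n, Measure.dirac (x i)

end MetricObservables

end

namespace MetricObservables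

variable {X : Type*} [MetricSpace X] [CompactSpace X] [MeasurableSpace X] [BorelSpace X]

/-! Randomness enters only once. The strong law holds almost surely for all members of a countable
dense subset of `C(X, ℝ)` at once, and since means over probability measures are 1-Lipschitz in the
function, convergence extends to every continuous function (`ae_forall_tendsto_meanFunctional`). The
rest is deterministic. Equicontinuity makes the convergence uniform on compact subsets of `C(X, ℝ)`.
The observables are not compact, because of constants, but those centered for any probability
measure lie in one compact set K, cut out by the bound `diam X`. Subtracting a constant shifts both
means equally, which gives (i). For (ii), uniformity on K and on K * K shows that recentering an
observable from one measure to the other moves the pair and its covariance only slightly. -/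

theorem integrable_continuousMap (ν : Measure X) [IsFiniteMeasure ν] (f : C(X, ℝ)) :
    Integrable f ν :=
  f.continuous.integrable_of_hasCompactSupport (HasCompactSupport.of_compactSpace f)

open ProbabilityTheory in
/-- The strong law of large numbers for one continuous function. -/
theorem ae_tendsto_meanFunctional_empiricalMeasure
    (μ : Measure X) [IsProbabilityMeasure μ] (f : C(X, ℝ)) :
    ∀ᵐ x ∂(Measure.infinitePi (fun _ : ℕ => μ)),
      Tendsto (fun n : ℕ => meanFunctional (empiricalMeasure x n) f) atTop
        (𝓝 (meanFunctional μ f)) := by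
  have hmp (i : ℕ) := measurePreserving_eval_infinitePi (fun _ : ℕ => μ) i
  have hf : Measurable f := f.continuous.measurable
  have hfi := integrable_continuousMap μ f
  have hind := iIndepFun_infinitePi (P := fun _ : ℕ => μ) (X := fun _ => f) fun _ => hf
  have key := strong_law_ae_real (μ := Measure.infinitePi (fun _ : ℕ => μ))
    (fun i x => f (x i)) ((hmp 0).integrable_comp_of_integrable hfi)
    (fun i j hij => hind.indepFun hij)
    (fun i => by
      refine ⟨(hf.comp (measurable_pi_apply i)).aemeasurable,
        (hf.comp (measurable_pi_apply 0)).aemeasurable, ?_⟩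
      change Measure.map (f ∘ fun x : ℕ → X => x i) _ = Measure.map (f ∘ fun x : ℕ → X => x 0) _
      rw [← Measure.map_map hf (measurable_pi_apply i),
        ← Measure.map_map hf (measurable_pi_apply 0),
        Measure.infinitePi_map_eval, Measure.infinitePi_map_eval])
  have hmean : ∫ x, f (x 0) ∂(Measure.infinitePi (fun _ : ℕ => μ)) = meanFunctional μ f := by
    unfold meanFunctional
    conv_rhs => rw [← (hmp 0).map_eq]
    rw [integral_map (hmp 0).measurable.aemeasurable hf.aestronglyMeasurable]
  rw [hmean] at key
  filter_upwards [key] with x hx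
  refine hx.congr fun n => ?_
  simp only [meanFunctional, empiricalMeasure, integral_smul_measure]
  rw [integral_finsetSum_measure fun i _ =>
    integrable_continuousMap _ f]
  simp [integral_dirac, div_eq_inv_mul]

theorem isProbabilityMeasure_empiricalMeasure {X : Type*} [MeasurableSpace X]
    (x : ℕ → X) {n : ℕ} (hn : n ≠ 0) :
    IsProbabilityMeasure (empiricalMeasure x n) := by
  constructor
  simp [empiricalMeasure, ENNReal.inv_mul_cancel, hn]

theorem lipschitzWith_meanFunctional (ν : Measure X) [IsProbabilityMeasure ν] :
    LipschitzWith 1 (meanFunctional ν) := by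
  refine LipschitzWith.of_dist_le_mul fun f g => ?_
  rw [Real.dist_eq, meanFunctional, meanFunctional,
    ← integral_sub (integrable_continuousMap ν f) (integrable_continuousMap ν g), NNReal.coe_one,
    one_mul]
  have h := norm_integral_le_of_norm_le_const (μ := ν) (f := fun a => f a - g a)
    (C := dist f g) (ae_of_all _ fun a => by
      rw [Real.norm_eq_abs, ← Real.dist_eq]; exact ContinuousMap.dist_apply_le_dist a)
  simpa using h

theorem uniformEquicontinuous_meanFunctional_empiricalMeasure (x : ℕ → X) :
    UniformEquicontinuous
      (fun (n : ℕ) (f : C(X, ℝ)) => meanFunctional (empiricalMeasure x n) f) := by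
  refine LipschitzWith.uniformEquicontinuous _ 1 fun n => ?_
  -- For `n = 0` the measure is zero, so the mean is the constant function 0.
  rcases eq_or_ne n 0 with rfl | hn
  · simpa [meanFunctional, empiricalMeasure] using LipschitzWith.const' (0 : ℝ)
  · have := isProbabilityMeasure_empiricalMeasure x hn
    exact lipschitzWith_meanFunctional _

/-- Almost surely the empirical measures converge weakly. -/
theorem ae_forall_tendsto_meanFunctional (μ : Measure X) [IsProbabilityMeasure μ] :
    ∀ᵐ x ∂(Measure.infinitePi (fun _ : ℕ => μ)), ∀ f : C(X, ℝ),
      Tendsto (fun n : ℕ => meanFunctional (empiricalMeasure x n) f) atTop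
        (𝓝 (meanFunctional μ f)) := by
  obtain ⟨D, hDc, hD⟩ := TopologicalSpace.exists_countable_dense C(X, ℝ)
  filter_upwards [(ae_ball_iff hDc).2 fun f _ =>
    ae_tendsto_meanFunctional_empiricalMeasure μ f] with x hx f
  -- By equicontinuity the functions whose means converge form a closed set; it contains the dense
  -- set `D`.
  have hcl := (uniformEquicontinuous_meanFunctional_empiricalMeasure x).equicontinuous
    |>.isClosed_setOfPred_tendsto (l := atTop) (lipschitzWith_meanFunctional μ).continuous
  exact hcl.closure_subset_iff.2 hx (hD f)

theorem tendstoUniformlyOn_meanFunctional_of_isCompact {μ : Measure X} {x : ℕ → X}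
    (hx : ∀ f : C(X, ℝ), Tendsto (fun n : ℕ => meanFunctional (empiricalMeasure x n) f) atTop
      (𝓝 (meanFunctional μ f))) {K : Set C(X, ℝ)} (hK : IsCompact K) :
    TendstoUniformlyOn (fun (n : ℕ) (f : C(X, ℝ)) => meanFunctional (empiricalMeasure x n) f)
      (meanFunctional μ) atTop K := by
  have h := (EquicontinuousOn.tendsto_uniformOnFun_iff_pi' (𝔖 := {K})
    (F := fun (n : ℕ) (f : C(X, ℝ)) => meanFunctional (empiricalMeasure x n) f)
    (by simpa using hK)
    (fun L _ => (uniformEquicontinuous_meanFunctional_empiricalMeasure x).equicontinuous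
      |>.equicontinuousOn L) atTop (meanFunctional μ)).2
    (tendsto_pi_nhds.2 fun f => hx f)
  exact UniformOnFun.tendsto_iff_tendstoUniformlyOn.1 h K rfl

/-- Arzelà–Ascoli: 1-Lipschitz functions are equicontinuous, and pointwise they form a closed subset
of a product of compact intervals. -/
theorem isCompact_observables_bounded {X : Type*} [MetricSpace X] [CompactSpace X] (R : ℝ) :
    IsCompact {f : C(X, ℝ) | f ∈ observables X ∧ ∀ a, |f a| ≤ R} := by
  have hlip (f : C(X, ℝ)) (hf : f ∈ observables X) : LipschitzWith 1 f := by
    simpa [observables, lipschitzWith_iff_dist_le_mul, Real.dist_eq] using hf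
  apply ArzelaAscoli.isCompact_of_equicontinuous
  · have himg : ContinuousMap.toFun '' {f : C(X, ℝ) | f ∈ observables X ∧ ∀ a, |f a| ≤ R} =
        {f : X → ℝ | ∀ a b, |f a - f b| ≤ dist a b} ∩
          Set.pi Set.univ fun _ => Set.Icc (-R) R := by
      ext f
      constructor
      · rintro ⟨g, hg, rfl⟩
        exact ⟨hg.1, fun a _ => abs_le.1 (hg.2 a)⟩
      · rintro ⟨h1, h2⟩
        have hc : LipschitzWith 1 f := by
          simpa [lipschitzWith_iff_dist_le_mul, Real.dist_eq] using h1
        exact ⟨⟨f, hc.continuous⟩, ⟨h1, fun a => abs_le.2 (h2 a trivial)⟩, rfl⟩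
    rw [himg]
    refine (isCompact_univ_pi fun _ => isCompact_Icc).inter_left ?_
    simp only [Set.ofPred_forall]
    exact isClosed_iInter fun a => isClosed_iInter fun b =>
      isClosed_le (by fun_prop) continuous_const
  · exact (LipschitzWith.uniformEquicontinuous _ 1 fun
      f : {f : C(X, ℝ) | f ∈ observables X ∧ ∀ a, |f a| ≤ R} =>
        hlip f.1 f.2.1).equicontinuous

/-- As `f` has mean zero, `f a` is the `ν`-average of `f a - f b` over `b`. The bound does not
depend on `ν`, so one compact set serves all empirical measures. -/
theorem abs_le_diam_of_mem_centeredObservables {ν : Measure X} [IsProbabilityMeasure ν]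
    {f : C(X, ℝ)} (hf : f ∈ centeredObservables ν) (a : X) :
    |f a| ≤ Metric.diam (Set.univ : Set X) := by
  have h := norm_integral_le_of_norm_le_const (μ := ν) (f := fun b => f a - f b)
    (C := Metric.diam (Set.univ : Set X)) (ae_of_all _ fun b => (hf.1 a b).trans
      (Metric.dist_le_diam_of_mem isCompact_univ.isBounded (Set.mem_univ _) (Set.mem_univ _)))
  rw [integral_sub (integrable_const _) (integrable_continuousMap ν f)] at h
  have h0 : ∫ b, f b ∂ν = 0 := hf.2
  simpa [h0] using h

theorem meanFunctional_sub_const (ν : Measure X) [IsProbabilityMeasure ν] (f : C(X, ℝ)) (c : ℝ) :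
    meanFunctional ν (f - ContinuousMap.const X c) = meanFunctional ν f - c := by
  have h := integral_sub (integrable_continuousMap ν f) (integrable_const c)
  simpa [meanFunctional] using h

theorem sub_mean_mem_centeredObservables (ν : Measure X) [IsProbabilityMeasure ν] {f : C(X, ℝ)}
    (hf : f ∈ observables X) :
    f - ContinuousMap.const X (meanFunctional ν f) ∈ centeredObservables ν := by
  refine ⟨fun a b => ?_, by simp [meanFunctional_sub_const]⟩
  simpa using hf a b

theorem integral_sub_mean_mul_sub_mean (ν : Measure X) [IsProbabilityMeasure ν] (f g : C(X, ℝ)) :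
    ∫ a, (f - ContinuousMap.const X (meanFunctional ν f)) a *
      (g - ContinuousMap.const X (meanFunctional ν g)) a ∂ν =
      meanFunctional ν (f * g) - meanFunctional ν f * meanFunctional ν g := by
  set c := meanFunctional ν f with hc
  set d := meanFunctional ν g with hd
  have h1 := integral_sub (integrable_continuousMap ν (f * g))
    ((integrable_continuousMap ν f).mul_const d)
  -- The integrand splits as `f * g - f * d - c * (g - d)`, and the last term integrates to zero.
  have h2 := integral_sub ((integrable_continuousMap ν (f * g)).sub
    ((integrable_continuousMap ν f).mul_const d))
    ((integrable_continuousMap ν (g - ContinuousMap.const X d)).const_mul c)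
  have h3 : ∫ a, (g - ContinuousMap.const X d) a ∂ν = 0 := by
    have := meanFunctional_sub_const ν g d
    rwa [← hd, sub_self] at this
  have h4 : ∫ a, f a * d ∂ν = c * d := by rw [integral_mul_const]; rfl
  rw [integral_const_mul, h3, mul_zero, sub_zero] at h2
  change _ = ∫ a, (f * g) a ∂ν - c * d
  rw [← h4, ← h1]
  simp only [Pi.sub_apply] at h2
  rw [← h2]
  congr 1
  ext a
  simp
  ring

/-- Recentering a pair of observables changes the pair and its covariance by little if the two
measures have nearly the same integrals. -/
theorem exists_centered_pair_near {ν ρ : Measure X} [IsProbabilityMeasure ρ]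
    {δ ε : ℝ} (hδε : δ + δ * δ < ε) (hδ : 0 ≤ δ) {f g : C(X, ℝ)} (hf : f ∈ centeredObservables ν)
    (hg : g ∈ centeredObservables ν)
    (hmf : |meanFunctional ν f - meanFunctional ρ f| ≤ δ)
    (hmg : |meanFunctional ν g - meanFunctional ρ g| ≤ δ)
    (hmfg : |meanFunctional ν (f * g) - meanFunctional ρ (f * g)| ≤ δ) :
    ∃ q : ↥(centeredObservables ρ ×ˢ centeredObservables ρ : Set (C(X, ℝ) × C(X, ℝ))),
      dist (f, g) (q : C(X, ℝ) × C(X, ℝ)) < ε ∧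
        |(∫ a, f a * g a ∂ν) - observableCovariance ρ q| < ε := by
  -- Since `f` and `g` are `ν`-centered, their `ρ`-means, the constants to be subtracted, are at
  -- most `δ` in absolute value.
  rw [hf.2, zero_sub, abs_neg] at hmf
  rw [hg.2, zero_sub, abs_neg] at hmg
  have hlt : δ < ε := by nlinarith
  have hd (h : C(X, ℝ)) (hm : |meanFunctional ρ h| ≤ δ) :
      dist h (h - ContinuousMap.const X (meanFunctional ρ h)) ≤ δ := by
    refine (ContinuousMap.dist_le hδ).2 fun a => ?_
    simpa [Real.dist_eq] using hm
  refine ⟨⟨(f - ContinuousMap.const X (meanFunctional ρ f),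
    g - ContinuousMap.const X (meanFunctional ρ g)),
    sub_mean_mem_centeredObservables ρ hf.1, sub_mean_mem_centeredObservables ρ hg.1⟩, ?_, ?_⟩
  · rw [Prod.dist_eq]
    exact (max_le (hd f hmf) (hd g hmg)).trans_lt hlt
  · unfold observableCovariance
    rw [integral_sub_mean_mul_sub_mean]
    change |meanFunctional ν (f * g) - _| < ε
    have hp : |meanFunctional ρ f * meanFunctional ρ g| ≤ δ * δ := by
      rw [abs_mul]
      exact mul_le_mul hmf hmg (abs_nonneg _) hδ
    rw [sub_sub_eq_add_sub, add_sub_right_comm]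
    exact (abs_add_le _ _).trans_lt ((add_le_add hmfg hp).trans_lt hδε)

theorem tendstoUniformlyOn_meanFunctional_observables {μ : Measure X} [IsProbabilityMeasure μ]
    {x : ℕ → X}
    (hx : ∀ f : C(X, ℝ), Tendsto (fun n : ℕ => meanFunctional (empiricalMeasure x n) f) atTop
      (𝓝 (meanFunctional μ f))) :
    TendstoUniformlyOn (fun (n : ℕ) (f : C(X, ℝ)) => meanFunctional (empiricalMeasure x n) f)
      (meanFunctional μ) atTop (observables X) := by
  have hK := tendstoUniformlyOn_meanFunctional_of_isCompact hx
    (isCompact_observables_bounded (X := X) (Metric.diam (Set.univ : Set X)))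
  rw [Metric.tendstoUniformlyOn_iff] at hK ⊢
  intro ε hε
  filter_upwards [hK ε hε, eventually_ne_atTop 0] with n hn hn0 f hf
  have := isProbabilityMeasure_empiricalMeasure x hn0
  -- The `μ`-mean of `f` is subtracted under both measures, so it cancels in the difference of the
  -- means.
  have hc := sub_mean_mem_centeredObservables μ hf
  have h := hn _ ⟨hc.1, abs_le_diam_of_mem_centeredObservables hc⟩
  rwa [meanFunctional_sub_const, meanFunctional_sub_const, dist_sub_right] at h

theorem tendsto_functionalHausdorffDist_observableCovariance {μ : Measure X}
    [IsProbabilityMeasure μ] {x : ℕ → X}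
    (hx : ∀ f : C(X, ℝ), Tendsto (fun n : ℕ => meanFunctional (empiricalMeasure x n) f) atTop
      (𝓝 (meanFunctional μ f))) :
    Tendsto (fun n : ℕ => functionalHausdorffDist (observableCovariance μ)
      (observableCovariance (empiricalMeasure x n))) atTop (𝓝 0) := by
  have hc := isCompact_observables_bounded (X := X) (Metric.diam (Set.univ : Set X))
  have hK := Metric.tendstoUniformlyOn_iff.1 (tendstoUniformlyOn_meanFunctional_of_isCompact hx hc)
  have hKK := Metric.tendstoUniformlyOn_iff.1
    (tendstoUniformlyOn_meanFunctional_of_isCompact hx (hc.mul hc))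
  rw [ENNReal.tendsto_nhds_zero]
  intro η hη
  obtain ⟨ε, hε, hεη⟩ : ∃ ε : ℝ, 0 < ε ∧ ENNReal.ofReal ε ≤ η := by
    obtain ⟨r, hr, hrη⟩ := ENNReal.lt_iff_exists_nnreal_btwn.1 hη
    exact ⟨r, by exact_mod_cast hr, by simpa using hrη.le⟩
  obtain ⟨δ, hδ, hδ1, hδε⟩ : ∃ δ : ℝ, 0 < δ ∧ δ ≤ 1 ∧ δ ≤ ε / 3 :=
    ⟨min 1 (ε / 3), by positivity, min_le_left _ _, min_le_right _ _⟩
  -- From `δ ≤ 1`, the left side is at most `2 * δ ≤ 2 * ε / 3`.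
  have hδε' : δ + δ * δ < ε := by nlinarith
  filter_upwards [hK δ hδ, hKK δ hδ, eventually_ne_atTop 0] with n h1 h2 hn0
  have := isProbabilityMeasure_empiricalMeasure x hn0
  refine (iInf₂_le ε ⟨hε, ?_, ?_⟩).trans hεη
  · rintro ⟨⟨f, g⟩, hf, hg⟩
    have hf' := And.intro hf.1 (abs_le_diam_of_mem_centeredObservables hf)
    have hg' := And.intro hg.1 (abs_le_diam_of_mem_centeredObservables hg)
    exact exists_centered_pair_near hδε' hδ.le hf hg (h1 f hf').le (h1 g hg').le
      (h2 _ (Set.mul_mem_mul hf' hg')).le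
  · rintro ⟨⟨f, g⟩, hf, hg⟩
    have hf' := And.intro hf.1 (abs_le_diam_of_mem_centeredObservables hf)
    have hg' := And.intro hg.1 (abs_le_diam_of_mem_centeredObservables hg)
    obtain ⟨q, hq1, hq2⟩ := exists_centered_pair_near (ρ := μ) hδε' hδ.le hf hg
      (by rw [abs_sub_comm]; exact (h1 f hf').le) (by rw [abs_sub_comm]; exact (h1 g hg').le)
      (by rw [abs_sub_comm]; exact (h2 _ (Set.mul_mem_mul hf' hg')).le)
    exact ⟨q, by rwa [dist_comm], by rwa [abs_sub_comm]⟩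

end MetricObservables

theorem mainTheorem5 {X : Type*} [MetricSpace X] [CompactSpace X] [MeasurableSpace X]
    [BorelSpace X] (μ : Measure X) [IsProbabilityMeasure μ] :
    (∀ᵐ x ∂(Measure.infinitePi (fun _ : ℕ => μ)),
      TendstoUniformlyOn
        (fun (n : ℕ) (f : C(X, ℝ)) =>
          MetricObservables.meanFunctional (MetricObservables.empiricalMeasure x n) f)
        (MetricObservables.meanFunctional μ) atTop (MetricObservables.observables X)) ∧
    (∀ᵐ x ∂(Measure.infinitePi (fun _ : ℕ => μ)),
      Tendsto
        (fun n : ℕ =>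
          MetricObservables.functionalHausdorffDist
            (MetricObservables.observableCovariance μ)
            (MetricObservables.observableCovariance (MetricObservables.empiricalMeasure x n)))
        atTop (𝓝 0)) := by

  have h := MetricObservables.ae_forall_tendsto_meanFunctional μ
  exact ⟨h.mono fun x hx => MetricObservables.tendstoUniformlyOn_meanFunctional_observables hx,
    h.mono fun x hx =>
      MetricObservables.tendsto_functionalHausdorffDist_observableCovariance hx⟩
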